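/- Let $\Sigma$ be a nonempty finite set of unary predicates (for instance a single one) and let $A=\mathcal P(\Sigma)$, so that finite words over the alphabet $A$ are finite linearly ordered structures in which $a(x)$ holds, for $a\in\Sigma$, if and only if $a$ belongs to the letter at position $x$. Let $\mathrm{FO}$ be the set of first-order formulas built from $\bot$, $\top$, the atoms $a(x)$ with $a\in\Sigma$, and the atoms $x=y$, $x\neq y$, $x\le y$, $x<y$, "$y$ is the successor of $x$", "$y$ is not the successor of $x$", by $\land,\lor,\exists,\forall,\neg$, with quantifiers ranging over the positions of the word; let $\mathrm{FO}^+$ be the set of formulas of $\mathrm{FO}$ in which $\neg$ does not occur. A language $L\subseteq A^*$ is definable in $\mathrm{FO}$ (resp. $\mathrm{FO}^+$) if it is the set of all words satisfying some closed formula of $\mathrm{FO}$ (resp. $\mathrm{FO}^+$), and it is monotone if, whenever $u\in L$ and $v\in A^*$ has the same length as $u$ and each letter of $u$ is included in the letter of $v$ at the same position, then $v\in L$. Then there exists a language $L\subseteq A^*$ that is monotone and definable in $\mathrm{FO}$ but not definable in $\mathrm{FO}^+$. -/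

import Mathlib

namespace WordLogic

/-- Binary predicates comparing positions of a word: `=`, `≠`, `≤`, `<`, successor, non-successor. -/
inductive BinPred : Type
  | eq | ne | le | lt | succ | nsucc

/-- Interpretation of the binary predicates on positions; `succ` relates `i` to `i + 1`. -/
def BinPred.Holds : BinPred → ℕ → ℕ → Prop
  | .eq, i, j => i = j
  | .ne, i, j => i ≠ j
  | .le, i, j => i ≤ j
  | .lt, i, j => i < j
  | .succ, i, j => j = i + 1
  | .nsucc, i, j => j ≠ i + 1

/-- First-order formulas over a set `S` of unary predicates, with free variables indexed by `Fin n`.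
A quantifier binds the variable `0` of its body (the variable `k + 1` of the body is the variable `k`
outside). Closed formulas are those with `n = 0`. -/
inductive FO (S : Type*) : ℕ → Type _
  | bot {n : ℕ} : FO S n
  | top {n : ℕ} : FO S n
  | bin {n : ℕ} (b : BinPred) (x y : Fin n) : FO S n
  | un {n : ℕ} (a : S) (x : Fin n) : FO S n
  | and {n : ℕ} (φ ψ : FO S n) : FO S n
  | or {n : ℕ} (φ ψ : FO S n) : FO S n
  | ex {n : ℕ} (φ : FO S (n + 1)) : FO S n
  | all {n : ℕ} (φ : FO S (n + 1)) : FO S n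
  | neg {n : ℕ} (φ : FO S n) : FO S n

/-- Satisfaction of a formula by a word over the alphabet of subsets of `S`, under a valuation of the
free variables by positions of the word. The atom `a(x)` asks that `a` belong to the letter at `x`. -/
def FO.Sat {S : Type*} (u : List (Set S)) : {n : ℕ} → FO S n → (Fin n → Fin u.length) → Prop
  | _, .bot, _ => False
  | _, .top, _ => True
  | _, .bin b x y, ν => b.Holds (ν x) (ν y)
  | _, .un a x, ν => a ∈ u.get (ν x)
  | _, .and φ ψ, ν => φ.Sat u ν ∧ ψ.Sat u ν
  | _, .or φ ψ, ν => φ.Sat u ν ∨ ψ.Sat u ν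
  | _, .ex φ, ν => ∃ i : Fin u.length, φ.Sat u (Fin.cons i ν)
  | _, .all φ, ν => ∀ i : Fin u.length, φ.Sat u (Fin.cons i ν)
  | _, .neg φ, ν => ¬ φ.Sat u ν

/-- The fragment FO⁺: formulas in which negation does not occur. -/
def FO.IsPositive {S : Type*} : {n : ℕ} → FO S n → Prop
  | _, .bot => True
  | _, .top => True
  | _, .bin _ _ _ => True
  | _, .un _ _ => True
  | _, .and φ ψ => φ.IsPositive ∧ ψ.IsPositive
  | _, .or φ ψ => φ.IsPositive ∧ ψ.IsPositive
  | _, .ex φ => φ.IsPositive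
  | _, .all φ => φ.IsPositive
  | _, .neg _ => False

/-- The language of a closed formula: the set of finite words (the empty word included) satisfying it. -/
def FO.language {S : Type*} (φ : FO S 0) : Language (Set S) :=
  {u : List (Set S) | φ.Sat u Fin.elim0}

/-- `L` is definable in FO. -/
def FODefinable {S : Type*} (L : Language (Set S)) : Prop :=
  ∃ φ : FO S 0, φ.language = L

/-- `L` is definable in FO⁺. -/
def FOPosDefinable {S : Type*} (L : Language (Set S)) : Prop :=
  ∃ φ : FO S 0, φ.IsPositive ∧ φ.language = L

/-- The order on words: same length, and letterwise inclusion. -/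
def WordLE {S : Type*} (u v : List (Set S)) : Prop :=
  List.Forall₂ (fun s t : Set S => s ⊆ t) u v

/-- `L` is monotone: it is closed under passing to greater words. -/
def IsMonotone {S : Type*} (L : Language (Set S)) : Prop :=
  ∀ u v : List (Set S), u ∈ L → WordLE u v → v ∈ L

end WordLogic

/-!
Fix a predicate `a` and call a position of a word marked if its letter contains `a`. The witness is
`tripleLanguage a`: the words with three consecutive marks, together with the words of length `1`
modulo `3` in which all positions divisible by `3` are marked. Adding marks preserves membership.

*First-order definability.* In a member of the second kind with no three consecutive marks, the
residue of a position modulo `3` can be recovered by a formula. An isolated mark sits at a multiple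
of `3`, since one of any three consecutive positions must be such a multiple. For a pair of adjacent
marks one looks to the left: as long as the word reads `110110…`, the role of the pairs does not
change, and the first irregularity met, either an isolated mark or two consecutive unmarked positions,
decides which mark of the pair is at a multiple of `3` (`head_iff`). A sentence then
only has to check that the positions singled out by this formula begin at the first position, end at
the last one, and are repeated exactly every third position (`HeadsRegular`); this check is correct
whether or not the formula means what it should (`mem_tripleLanguage_iff`).

*No positive sentence works.* The word `(100)^N 1` is in the language and `(110)^N 11` is not. Yet a
positive formula of rank small with respect to `N` that holds in the former holds in the latter. In
the one-sided Ehrenfeucht–Fraïssé game, pebbles near the left end are matched with difference `0`,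
pebbles near the right end with difference `-1`, and both kinds of match send marks to marks. The
change of phase takes place in a gap too long to be explored in the remaining rounds
(`IsConfig.exists_insert`, `FO.IsPositive.sat_of_isConfig`).
-/

namespace WordLogic

variable {S : Type*}

/-- A position is marked in `u` if its letter contains `a`; positions outside `u` are not. -/
def Marked (a : S) (u : List (Set S)) (i : ℕ) : Prop :=
  ∃ h : i < u.length, a ∈ u[i]

/-- Three consecutive positions of `M`. -/
def HasTriple (M : ℕ → Prop) : Prop :=
  ∃ i, M i ∧ M (i + 1) ∧ M (i + 2)

/-- The language of words that contain three consecutive marks, or whose length is `1` modulo `3`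
and whose positions divisible by `3` are all marked. -/
def tripleLanguage (a : S) : Language (Set S) :=
  {u : List (Set S) | HasTriple (Marked a u) ∨
    (u.length % 3 = 1 ∧ ∀ i < u.length, i % 3 = 0 → Marked a u i)}

theorem Marked.mono {a : S} {u v : List (Set S)} (h : WordLE u v) {i : ℕ} (hi : Marked a u i) :
    Marked a v i := by
  obtain ⟨hl, ha⟩ := hi
  have hv : i < v.length := List.Forall₂.length_eq h ▸ hl
  exact ⟨hv, List.Forall₂.get h hl hv ha⟩

theorem isMonotone_tripleLanguage (a : S) : IsMonotone (tripleLanguage a) := by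
  rintro u v (⟨i, h0, h1, h2⟩ | ⟨hl, hu⟩) h
  · exact Or.inl ⟨i, h0.mono h, h1.mono h, h2.mono h⟩
  · have hlen : u.length = v.length := List.Forall₂.length_eq h
    exact Or.inr ⟨hlen ▸ hl, fun i hi h3 => (hu i (hlen ▸ hi) h3).mono h⟩

/-! ### Recovering residues modulo three -/

/-- A mark with no marked neighbour; the missing left neighbour of position `0` counts as
unmarked. -/
def Isolated (M : ℕ → Prop) (i : ℕ) : Prop :=
  M i ∧ ¬ M (i + 1) ∧ ¬ ∃ j, i = j + 1 ∧ M j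

/-- Some isolated mark precedes `i`, and the positions strictly between them contain no other
isolated mark and start no pair of consecutive unmarked positions. In a word of period `110`
continuing an isolated mark, this says that the second mark of each pair is the one in phase. -/
def Trailing (M : ℕ → Prop) (i : ℕ) : Prop :=
  ∃ q, q < i ∧ Isolated M q ∧ ∀ r, q < r → r < i → ¬ Isolated M r ∧ (M r ∨ M (r + 1))

/-- A first-order definable candidate for the property of being divisible by `3`. -/
def Head (M : ℕ → Prop) (i : ℕ) : Prop :=
  Isolated M i ∨ (M i ∧ M (i + 1) ∧ ¬ Trailing M i) ∨ ((∃ j, i = j + 1 ∧ M j) ∧ M i ∧ Trailing M i)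

section Residues

variable {M : ℕ → Prop} {l : ℕ}

theorem Isolated.mod_three (hM : ∀ i, i ≤ 3 * l → i % 3 = 0 → M i)
    (hout : ∀ i, M i → i ≤ 3 * l) {i : ℕ} (hi : Isolated M i) : i % 3 = 0 := by
  obtain ⟨h0, h1, h2⟩ := hi
  have := hout i h0
  by_contra hne
  rcases (by omega : i % 3 = 1 ∨ i % 3 = 2) with h | h
  · exact h2 ⟨i - 1, by omega, hM _ (by omega) (by omega)⟩
  · exact h1 (hM _ (by omega) (by omega))

/-- If the first mark of a pair is at a multiple of `3`, the same holds for every pair that precedes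
it without an irregularity in between, so that the last irregularity cannot be an isolated mark. -/
theorem not_trailing (hT : ¬ HasTriple M) (hM : ∀ i, i ≤ 3 * l → i % 3 = 0 → M i)
    (hout : ∀ i, M i → i ≤ 3 * l) {k i : ℕ} (hk : M (3 * k + 1)) (hi : 3 * k ≤ i) (hi' : i ≤ 3 * k + 1) :
    ¬ Trailing M i := by
  rintro ⟨q, hq, hiso, hr⟩
  have hq3 := hiso.mod_three hM hout
  have hkl := hout _ hk
  obtain ⟨j, rfl⟩ : ∃ j, q = 3 * j := ⟨q / 3, by omega⟩
  have key : ∀ d, j + d ≤ k → ¬ M (3 * (j + d) + 1) := by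
    intro d
    induction d with
    | zero => intro _; exact hiso.2.1
    | succ d ih =>
      intro hd h4
      have h1 := ih (by omega)
      have h2 : M (3 * (j + d) + 1 + 1) := (hr (3 * (j + d) + 1) (by omega) (by omega)).2.resolve_left h1
      exact hT ⟨_, h2, hM _ (by omega) (by omega), h4⟩
  exact key (k - j) (by omega) (by rwa [show j + (k - j) = k by omega])

/-- If the second mark of a pair is at a multiple of `3`, then so it is for the earlier pairs of the
run `110110…`, and the mark at the multiple of `3` just before that run is isolated. -/
theorem trailing (hT : ¬ HasTriple M) (hM : ∀ i, i ≤ 3 * l → i % 3 = 0 → M i) {k : ℕ}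
    (hkl : 3 * k + 3 ≤ 3 * l) (hk : M (3 * k + 2)) :
    Trailing M (3 * k + 2) ∧ Trailing M (3 * k + 3) := by
  have hmid : ∀ k, 3 * k + 3 ≤ 3 * l → M (3 * k + 2) → ¬ M (3 * k + 1) := fun k hl h2 h1 =>
    hT ⟨_, h1, h2, hM _ (by omega) (by omega)⟩
  have hstep : ∀ k, 3 * k + 3 ≤ 3 * l → M (3 * k + 2) → Trailing M (3 * k + 2) →
      Trailing M (3 * k + 3) := by
    rintro k hl h2 ⟨q, hq, hiso, hr⟩
    refine ⟨q, by omega, hiso, fun r h1 h3 => ?_⟩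
    rcases (by omega : r < 3 * k + 2 ∨ r = 3 * k + 2) with h | rfl
    · exact hr r h1 h
    · exact ⟨fun h => h.2.1 (hM _ (by omega) (by omega)), Or.inl h2⟩
  suffices h : Trailing M (3 * k + 2) from ⟨h, hstep k hkl hk h⟩
  induction k with
  | zero =>
    refine ⟨0, by omega, ⟨hM _ (by omega) (by omega), hmid 0 hkl hk, by simp⟩, fun r h0 h2 => ?_⟩
    obtain rfl : r = 1 := by omega
    exact ⟨fun h => hmid 0 hkl hk h.1, Or.inr hk⟩
  | succ k ih =>
    have hm := hmid _ hkl hk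
    by_cases h2 : M (3 * k + 2)
    · obtain ⟨q, hq, hiso, hr⟩ := hstep k (by omega) h2 (ih (by omega) h2)
      refine ⟨q, by omega, hiso, fun r h1 h3 => ?_⟩
      rcases (by omega : r < 3 * k + 3 ∨ r = 3 * k + 3 ∨ r = 3 * (k + 1) + 1) with h | rfl | rfl
      · exact hr r h1 h
      · exact ⟨fun h => h.2.2 ⟨_, rfl, h2⟩, Or.inl (hM _ (by omega) (by omega))⟩
      · exact ⟨fun h => hm h.1, Or.inr hk⟩
    · refine ⟨3 * (k + 1), by omega, ⟨hM _ (by omega) (by omega), hm, ?_⟩, fun r h0 h3 => ?_⟩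
      · rintro ⟨j, hj, hj'⟩
        obtain rfl : j = 3 * k + 2 := by omega
        exact h2 hj'
      · obtain rfl : r = 3 * (k + 1) + 1 := by omega
        exact ⟨fun h => hm h.1, Or.inr hk⟩

theorem head_iff (hT : ¬ HasTriple M) (hM : ∀ i, i ≤ 3 * l → i % 3 = 0 → M i)
    (hout : ∀ i, M i → i ≤ 3 * l) {i : ℕ} (hi : i ≤ 3 * l) : Head M i ↔ i % 3 = 0 := by
  constructor
  · rintro (h | ⟨h0, h1, h2⟩ | ⟨⟨j, rfl, h0⟩, h1, h2⟩)
    · exact h.mod_three hM hout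
    · by_contra hne
      rcases (by omega : i % 3 = 1 ∨ i % 3 = 2) with h | h
      · exact hT ⟨i - 1, hM _ (by omega) (by omega), by rwa [show i - 1 + 1 = i by omega],
          by rwa [show i - 1 + 2 = i + 1 by omega]⟩
      · obtain ⟨k, rfl⟩ : ∃ k, i = 3 * k + 2 := ⟨i / 3, by omega⟩
        exact h2 (trailing hT hM (by omega) h0).1
    · by_contra hne
      rcases (by omega : j % 3 = 0 ∨ j % 3 = 1) with h | h
      · obtain ⟨k, rfl⟩ : ∃ k, j = 3 * k := ⟨j / 3, by omega⟩
        exact not_trailing hT hM hout h1 (by omega) le_rfl h2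
      · exact hT ⟨j, h0, h1, hM _ (by omega) (by omega)⟩
  · intro h
    have h0 := hM i hi h
    by_cases h1 : M (i + 1)
    · obtain ⟨k, rfl⟩ : ∃ k, i = 3 * k := ⟨i / 3, by omega⟩
      exact Or.inr (Or.inl ⟨h0, h1, not_trailing hT hM hout h1 le_rfl (by omega)⟩)
    · by_cases h2 : ∃ j, i = j + 1 ∧ M j
      · obtain ⟨j, rfl, hj⟩ := h2
        obtain ⟨k, rfl⟩ : ∃ k, j = 3 * k + 2 := ⟨j / 3, by omega⟩
        exact Or.inr (Or.inr ⟨⟨_, rfl, hj⟩, h0, (trailing hT hM (by omega) hj).2⟩)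
      · exact Or.inl ⟨h0, h1, h2⟩

/-- The local conditions that pin a predicate down as divisibility by `3` on a word of length `n`,
and force `n` to be `1` modulo `3`. -/
def HeadsRegular (C : ℕ → Prop) (n : ℕ) : Prop :=
  (∃ i < n, i = 0 ∧ C i) ∧ (∃ i < n, i + 1 = n ∧ C i) ∧
    ∀ i < n, ∀ j < n, C i → (j = i + 1 → ¬ C j) ∧ (j = i + 2 → ¬ C j) ∧ (j = i + 3 → C j)

theorem HeadsRegular.iff_mod_three {C : ℕ → Prop} {n : ℕ} (h : HeadsRegular C n) {i : ℕ}
    (hi : i < n) : C i ↔ i % 3 = 0 := by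
  obtain ⟨⟨i0, h0n, rfl, h0⟩, -, hs⟩ := h
  have h3 : ∀ k, 3 * k < n → C (3 * k) := by
    intro k
    induction k with
    | zero => intro _; exact h0
    | succ k ih =>
      intro hk
      exact (hs (3 * k) (by omega) (3 * (k + 1)) hk (ih (by omega))).2.2 (by omega)
  have hh := hs (3 * (i / 3)) (by omega) i hi (h3 _ (by omega))
  rcases (by omega : i % 3 = 0 ∨ i % 3 = 1 ∨ i % 3 = 2) with h | h | h
  · have := h3 (i / 3) (by omega)
    rw [show 3 * (i / 3) = i by omega] at this
    exact iff_of_true this h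
  · exact iff_of_false (hh.1 (by omega)) (by omega)
  · exact iff_of_false (hh.2.1 (by omega)) (by omega)

theorem Head.self {i : ℕ} (h : Head M i) : M i := by
  rcases h with h | h | h
  exacts [h.1, h.1, h.2.1]

end Residues

theorem mem_tripleLanguage_iff (a : S) (u : List (Set S)) :
    u ∈ tripleLanguage a ↔
      HasTriple (Marked a u) ∨ HeadsRegular (Head (Marked a u)) u.length := by
  change _ ∨ _ ↔ _
  by_cases hT : HasTriple (Marked a u)
  · simp [hT]
  simp only [hT, false_or]
  constructor
  · rintro ⟨hl, hM⟩
    have hC : ∀ i, i < u.length → (Head (Marked a u) i ↔ i % 3 = 0) := fun i hi =>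
      head_iff (l := u.length / 3) hT (fun i h1 h2 => hM i (by omega) h2)
        (fun i h => by have := h.1; omega) (by omega)
    refine ⟨⟨0, by omega, rfl, (hC 0 (by omega)).2 rfl⟩,
      ⟨u.length - 1, by omega, by omega, (hC _ (by omega)).2 (by omega)⟩, fun i hi j hj h => ?_⟩
    rw [hC i hi] at h
    rw [hC j hj]
    omega
  · intro h
    refine ⟨?_, fun i hi h3 => ((h.iff_mod_three hi).2 h3).self⟩
    obtain ⟨i, hi, hil, hc⟩ := h.2.1
    have := (h.iff_mod_three hi).1 hc
    omega

/-! ### The defining sentence -/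

namespace FO

variable {n : ℕ}

/-- The successor of `x` is marked. -/
def nextMarked (a : S) (x : Fin n) : FO S n :=
  .ex (.and (.bin .succ x.succ 0) (.un a 0))

/-- The predecessor of `x` is marked. -/
def prevMarked (a : S) (x : Fin n) : FO S n :=
  .ex (.and (.bin .succ 0 x.succ) (.un a 0))

/-- The formula for `Isolated`. -/
def isolated (a : S) (x : Fin n) : FO S n :=
  .and (.un a x) (.and (.neg (nextMarked a x)) (.neg (prevMarked a x)))

/-- The formula for `Trailing`. -/
def trailing (a : S) (x : Fin n) : FO S n :=
  .ex (.and (.bin .lt 0 x.succ) (.and (isolated a 0)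
    (.all (.or (.neg (.and (.bin .lt 1 0) (.bin .lt 0 x.succ.succ)))
      (.and (.neg (isolated a 0)) (.or (.un a 0) (nextMarked a 0)))))))

/-- The formula for `Head`. -/
def head (a : S) (x : Fin n) : FO S n :=
  .or (isolated a x) (.or (.and (.un a x) (.and (nextMarked a x) (.neg (trailing a x))))
    (.and (prevMarked a x) (.and (.un a x) (trailing a x))))

variable {a : S} {u : List (Set S)} {ν : Fin n → Fin u.length} {x : Fin n}

theorem sat_un : (FO.un a x).Sat u ν ↔ Marked a u (ν x) := by
  simp [Sat, Marked]

theorem sat_nextMarked : (nextMarked a x).Sat u ν ↔ Marked a u (ν x + 1) := by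
  simp only [nextMarked, Sat, BinPred.Holds, Fin.cons_succ, Fin.cons_zero, List.get_eq_getElem]
  constructor
  · rintro ⟨i, h, hi⟩
    exact h ▸ ⟨i.2, hi⟩
  · rintro ⟨h, hi⟩
    exact ⟨⟨_, h⟩, rfl, hi⟩

theorem sat_prevMarked : (prevMarked a x).Sat u ν ↔ ∃ j, (ν x : ℕ) = j + 1 ∧ Marked a u j := by
  simp only [prevMarked, Sat, BinPred.Holds, Fin.cons_succ, Fin.cons_zero, List.get_eq_getElem]
  constructor
  · rintro ⟨i, h, hi⟩
    exact ⟨i, h, i.2, hi⟩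
  · rintro ⟨j, h, hj, hi⟩
    exact ⟨⟨_, hj⟩, h, hi⟩

theorem sat_isolated : (isolated a x).Sat u ν ↔ Isolated (Marked a u) (ν x) := by
  rw [Isolated, ← sat_prevMarked, ← sat_nextMarked, ← sat_un]
  rfl

theorem sat_trailing : (trailing a x).Sat u ν ↔ Trailing (Marked a u) (ν x) := by
  simp only [trailing, Sat, sat_isolated, sat_nextMarked, Trailing, BinPred.Holds, Fin.cons_succ,
    Fin.cons_zero, Fin.cons_one]
  constructor
  · rintro ⟨q, hq, hiso, h⟩
    refine ⟨q, hq, hiso, fun r h1 h2 => ?_⟩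
    obtain ⟨h3, h4⟩ := (h ⟨r, h2.trans (ν x).2⟩).resolve_left fun h => h ⟨h1, h2⟩
    exact ⟨h3, h4.imp_left fun h4 => ⟨_, h4⟩⟩
  · rintro ⟨q, hq, hiso, h⟩
    refine ⟨⟨q, hq.trans (ν x).2⟩, hq, hiso, fun r => ?_⟩
    by_cases hr : q < r ∧ (r : ℕ) < ν x
    · obtain ⟨h3, h4⟩ := h r hr.1 hr.2
      exact Or.inr ⟨h3, h4.imp_left fun h4 => h4.2⟩
    · exact Or.inl hr

theorem sat_head : (head a x).Sat u ν ↔ Head (Marked a u) (ν x) := by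
  rw [Head, ← sat_prevMarked, ← sat_nextMarked, ← sat_un, ← sat_isolated, ← sat_trailing]
  rfl

/-- The position `y` is `x + 2`. -/
def plusTwo (x y : Fin n) : FO S n :=
  .ex (.and (.bin .succ x.succ 0) (.bin .succ 0 y.succ))

/-- The position `y` is `x + 3`. -/
def plusThree (x y : Fin n) : FO S n :=
  .ex (.and (.bin .succ x.succ 0) (plusTwo 0 y.succ))

theorem sat_plusTwo {y : Fin n} : (plusTwo x y).Sat u ν ↔ (ν y : ℕ) = ν x + 2 := by
  simp only [plusTwo, Sat, BinPred.Holds, Fin.cons_succ, Fin.cons_zero]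
  constructor
  · rintro ⟨i, h1, h2⟩
    omega
  · intro h
    exact ⟨⟨ν x + 1, by have := (ν y).2; omega⟩, rfl, h⟩

theorem sat_plusThree {y : Fin n} : (plusThree x y).Sat u ν ↔ (ν y : ℕ) = ν x + 3 := by
  simp only [plusThree, Sat, sat_plusTwo, BinPred.Holds, Fin.cons_succ, Fin.cons_zero]
  constructor
  · rintro ⟨i, h1, h2⟩
    omega
  · intro h
    exact ⟨⟨ν x + 1, by have := (ν y).2; omega⟩, rfl, h⟩

/-- The sentence for `HasTriple`. -/
def hasTriple (a : S) : FO S 0 :=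
  .ex (.and (.un a 0) (.and (nextMarked a 0) (.ex (.and (.bin .succ 1 0) (nextMarked a 0)))))

theorem sat_hasTriple {ν : Fin 0 → Fin u.length} :
    (hasTriple a).Sat u ν ↔ HasTriple (Marked a u) := by
  simp only [hasTriple, Sat, sat_nextMarked, HasTriple, BinPred.Holds, Fin.cons_zero, Fin.cons_one]
  constructor
  · rintro ⟨i, h0, h1, j, hj, h2⟩
    exact ⟨i, ⟨i.2, h0⟩, h1, by rwa [hj] at h2⟩
  · rintro ⟨i, ⟨hi, h0⟩, h1, h2⟩
    exact ⟨⟨i, hi⟩, h0, h1, ⟨i + 1, h1.1⟩, rfl, h2⟩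

/-- The sentence for `HeadsRegular` applied to `Head`. -/
def headsRegular (a : S) : FO S 0 :=
  .and (.ex (.and (.all (.bin .le 1 0)) (head a 0)))
    (.and (.ex (.and (.all (.bin .le 0 1)) (head a 0)))
      (.all (.all (.or (.neg (head a 1))
        (.and (.neg (.and (.bin .succ 1 0) (head a 0)))
          (.and (.neg (.and (plusTwo 1 0) (head a 0)))
            (.or (.neg (plusThree 1 0)) (head a 0))))))))

theorem sat_headsRegular {ν : Fin 0 → Fin u.length} :
    (headsRegular a).Sat u ν ↔ HeadsRegular (Head (Marked a u)) u.length := by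
  simp only [headsRegular, Sat, sat_head, sat_plusTwo, sat_plusThree, BinPred.Holds, Fin.cons_zero,
    Fin.cons_one, HeadsRegular, Fin.exists_iff, Fin.forall_iff]
  refine and_congr ?_ (and_congr ?_ ?_)
  · refine exists_congr fun i => exists_prop.trans (and_congr_right fun hi => and_congr_left fun _ => ?_)
    exact ⟨fun h => Nat.le_zero.1 (h 0 (by omega)), fun h j _ => h ▸ j.zero_le⟩
  · refine exists_congr fun i => exists_prop.trans (and_congr_right fun hi => and_congr_left fun _ => ?_)
    exact ⟨fun h => by have := h (u.length - 1) (by omega); omega, fun h j _ => by omega⟩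
  · refine forall₂_congr fun i _ => forall₂_congr fun j _ => ?_
    simp only [imp_iff_not_or, not_and_or]

end FO

theorem foDefinable_tripleLanguage (a : S) : FODefinable (tripleLanguage a) := by
  refine ⟨.or (FO.hasTriple a) (FO.headsRegular a), Set.ext fun u => ?_⟩
  refine Iff.trans ?_ (mem_tripleLanguage_iff a u).symm
  exact or_congr FO.sat_hasTriple FO.sat_headsRegular

/-! ### A one-sided Ehrenfeucht–Fraïssé game -/

/-- The quantifier rank. -/
def FO.rank : {n : ℕ} → FO S n → ℕ
  | _, .bot => 0
  | _, .top => 0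
  | _, .bin _ _ _ => 0
  | _, .un _ _ => 0
  | _, .and φ ψ => max φ.rank ψ.rank
  | _, .or φ ψ => max φ.rank ψ.rank
  | _, .ex φ => φ.rank + 1
  | _, .all φ => φ.rank + 1
  | _, .neg φ => φ.rank

/-- Two pairs of positions are compatible up to distance `D` if their displacements agree in both
components, or are at least `D` in absolute value and have the same sign. -/
def Compat (D : ℤ) (x y : ℤ × ℤ) : Prop :=
  y.1 - x.1 = y.2 - x.2 ∨ (D ≤ y.1 - x.1 ∧ D ≤ y.2 - x.2) ∨ (D ≤ x.1 - y.1 ∧ D ≤ x.2 - y.2)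

/-- The configurations of the game: finite sets of pairwise compatible pairs of positions, whose
differences satisfy `R`. -/
structure IsConfig (R : ℤ → Prop) (D : ℤ) (P : Finset (ℤ × ℤ)) : Prop where
  diff : ∀ x ∈ P, R (x.1 - x.2)
  compat : ∀ x ∈ P, ∀ y ∈ P, Compat D x y

theorem Compat.symm {D : ℤ} {x y : ℤ × ℤ} (h : Compat D x y) : Compat D y x := by
  unfold Compat at *
  omega

theorem Compat.anti {D E : ℤ} (hDE : D ≤ E) {x y : ℤ × ℤ} (h : Compat E x y) : Compat D x y := by
  unfold Compat at *
  omega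

theorem IsConfig.swap {R : ℤ → Prop} {D : ℤ} {P : Finset (ℤ × ℤ)} (h : IsConfig R D P) :
    IsConfig (fun z => R (-z)) D (P.image Prod.swap) := by
  refine ⟨?_, ?_⟩
  · simp only [Finset.mem_image]
    rintro _ ⟨x, hx, rfl⟩
    simpa using h.diff x hx
  · simp only [Finset.mem_image]
    rintro _ ⟨x, hx, rfl⟩ _ ⟨y, hy, rfl⟩
    have := h.compat x hx y hy
    simp only [Compat, Prod.fst_swap, Prod.snd_swap] at *
    omega

/-- The answer to a move between two neighbouring pairs `a` and `b`: keep the distance to the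
neighbour that is close, and otherwise any point far from both with difference divisible by `3`. -/
theorem exists_between {R : ℤ → Prop} (hR : ∀ z, 3 ∣ z → R z) {D : ℤ} (hD : 2 ≤ D) {a b : ℤ × ℤ}
    (ha : R (a.1 - a.2)) (hb : R (b.1 - b.2)) (hab : Compat (3 * D) a b) {q : ℤ} (haq : a.2 ≤ q)
    (hqb : q ≤ b.2) :
    ∃ p, a.1 ≤ p ∧ p ≤ b.1 ∧ R (p - q) ∧ Compat D a (p, q) ∧ Compat D (p, q) b := by
  unfold Compat at *
  by_cases h1 : q - a.2 < D ∨ b.1 - a.1 = b.2 - a.2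
  · refine ⟨a.1 + (q - a.2), by omega, by omega, ?_, by omega, by omega⟩
    rwa [show a.1 + (q - a.2) - q = a.1 - a.2 by ring]
  by_cases h2 : b.2 - q < D
  · refine ⟨b.1 - (b.2 - q), by omega, by omega, ?_, by omega, by omega⟩
    rwa [show b.1 - (b.2 - q) - q = b.1 - b.2 by ring]
  · refine ⟨a.1 + D + (q - a.1 - D) % 3, by omega, by omega, hR _ (by omega), by omega, by omega⟩

theorem IsConfig.exists_insert {R : ℤ → Prop} (hR : ∀ z, 3 ∣ z → R z) {D : ℤ} (hD : 2 ≤ D)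
    {P : Finset (ℤ × ℤ)} (hP : IsConfig R (3 * D) P) {l r : ℤ × ℤ} (hl : l ∈ P) (hr : r ∈ P) {q : ℤ}
    (hlq : l.2 ≤ q) (hqr : q ≤ r.2) :
    ∃ p, l.1 ≤ p ∧ p ≤ r.1 ∧ IsConfig R D (insert (p, q) P) := by
  obtain ⟨a, ha, hamax⟩ := (P.filter (fun x => x.2 ≤ q)).exists_max_image Prod.snd
    ⟨l, Finset.mem_filter.2 ⟨hl, hlq⟩⟩
  obtain ⟨b, hb, hbmin⟩ := (P.filter (fun x => q ≤ x.2)).exists_min_image Prod.snd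
    ⟨r, Finset.mem_filter.2 ⟨hr, hqr⟩⟩
  simp only [Finset.mem_filter] at ha hb hamax hbmin
  have hab := hP.compat a ha.1 b hb.1
  obtain ⟨p, hap, hpb, hpR, hca, hcb⟩ :=
    exists_between hR hD (hP.diff a ha.1) (hP.diff b hb.1) hab ha.2 hb.2
  have hnew : ∀ x ∈ P, Compat D x (p, q) := by
    intro x hx
    have h1 := hP.compat x hx a ha.1
    have h2 := hP.compat x hx b hb.1
    rcases le_total x.2 q with h | h
    · have := hamax x ⟨hx, h⟩
      unfold Compat at *
      omega
    · have := hbmin x ⟨hx, h⟩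
      unfold Compat at *
      omega
  refine ⟨p, ?_, ?_, ?_, ?_⟩
  · have h1 := hP.compat l hl a ha.1
    have := hamax l ⟨hl, hlq⟩
    unfold Compat at h1
    omega
  · have h1 := hP.compat r hr b hb.1
    have := hbmin r ⟨hr, hqr⟩
    unfold Compat at h1
    omega
  · intro x hx
    rcases Finset.mem_insert.1 hx with rfl | hx
    exacts [hpR, hP.diff x hx]
  · intro x hx y hy
    rcases Finset.mem_insert.1 hx with rfl | hx <;> rcases Finset.mem_insert.1 hy with rfl | hy
    · exact Or.inl (by ring)
    · exact (hnew y hy).symm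
    · exact hnew x hx
    · exact (hP.compat x hx y hy).anti (by omega)

theorem IsConfig.exists_insert_swap {R : ℤ → Prop} (hR : ∀ z, 3 ∣ z → R z) {D : ℤ} (hD : 2 ≤ D)
    {P : Finset (ℤ × ℤ)} (hP : IsConfig R (3 * D) P) {l r : ℤ × ℤ} (hl : l ∈ P) (hr : r ∈ P) {p : ℤ}
    (hlp : l.1 ≤ p) (hpr : p ≤ r.1) :
    ∃ q, l.2 ≤ q ∧ q ≤ r.2 ∧ IsConfig R D (insert (p, q) P) := by
  obtain ⟨q, h1, h2, h3⟩ := hP.swap.exists_insert (fun z hz => hR _ (dvd_neg.2 hz)) hD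
    (Finset.mem_image_of_mem Prod.swap hl) (Finset.mem_image_of_mem Prod.swap hr) hlp hpr
  refine ⟨q, h1, h2, ?_⟩
  have := h3.swap
  simpa [Finset.image_insert, Finset.image_image] using this

theorem BinPred.holds_of_compat {i j i' j' : ℕ} (h : Compat 2 ((i : ℤ), (i' : ℤ)) (j, j'))
    (b : BinPred) (hb : b.Holds i j) : b.Holds i' j' := by
  unfold Compat at h
  cases b <;> simp only [BinPred.Holds] at * <;> omega

/-- If letters only grow along pairs of positions whose difference satisfies `R`, then positive
formulas of rank at most `k` are preserved along configurations up to distance `2 * 3 ^ k`. -/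
theorem FO.IsPositive.sat_of_isConfig {R : ℤ → Prop} (hR : ∀ z, 3 ∣ z → R z) {u v : List (Set S)}
    (hletter : ∀ (i : Fin u.length) (j : Fin v.length), R ((i : ℤ) - j) → u.get i ⊆ v.get j) {n : ℕ}
    (φ : FO S n) : φ.IsPositive → ∀ {k : ℕ}, φ.rank ≤ k → ∀ {P : Finset (ℤ × ℤ)},
      IsConfig R (2 * 3 ^ k) P → (0, 0) ∈ P → ((u.length : ℤ) - 1, (v.length : ℤ) - 1) ∈ P →
      ∀ (ν : Fin n → Fin u.length) (μ : Fin n → Fin v.length),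
        (∀ x, (((ν x : ℕ) : ℤ), ((μ x : ℕ) : ℤ)) ∈ P) → φ.Sat u ν → φ.Sat v μ := by
  have hpow : ∀ k : ℕ, (2 : ℤ) ≤ 2 * 3 ^ k := fun k => by
    have : (1 : ℤ) ≤ 3 ^ k := one_le_pow₀ (by norm_num)
    omega
  have hcons : ∀ {n : ℕ} {P : Finset (ℤ × ℤ)} {ν : Fin n → Fin u.length} {μ : Fin n → Fin v.length}
      (i : Fin u.length) (j : Fin v.length),
      (∀ x, (((ν x : ℕ) : ℤ), ((μ x : ℕ) : ℤ)) ∈ P) →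
      ∀ x, ((((Fin.cons i ν : Fin (n + 1) → Fin u.length) x : ℕ) : ℤ),
        (((Fin.cons j μ : Fin (n + 1) → Fin v.length) x : ℕ) : ℤ)) ∈
          insert (((i : ℕ) : ℤ), ((j : ℕ) : ℤ)) P := by
    intro n P ν μ i j h x
    refine Fin.cases ?_ (fun x => ?_) x
    · simp
    · simpa using Or.inr (h x)
  induction φ with
  | bot => intro _ k _ P _ _ _ ν μ _ h; exact h
  | top => intro _ k _ P _ _ _ ν μ _ h; exact h
  | bin b x y =>
    intro _ k _ P hP _ _ ν μ hν h
    exact BinPred.holds_of_compat ((hP.compat _ (hν x) _ (hν y)).anti (hpow k)) b h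
  | un a x =>
    intro _ k _ P hP _ _ ν μ hν h
    exact hletter _ _ (hP.diff _ (hν x)) h
  | and φ ψ ihφ ihψ =>
    intro hpos k hk P hP h0 h1 ν μ hν h
    exact ⟨ihφ hpos.1 ((le_max_left _ _).trans hk) hP h0 h1 ν μ hν h.1,
      ihψ hpos.2 ((le_max_right _ _).trans hk) hP h0 h1 ν μ hν h.2⟩
  | or φ ψ ihφ ihψ =>
    intro hpos k hk P hP h0 h1 ν μ hν h
    exact h.imp (ihφ hpos.1 ((le_max_left _ _).trans hk) hP h0 h1 ν μ hν)
      (ihψ hpos.2 ((le_max_right _ _).trans hk) hP h0 h1 ν μ hν)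
  | ex φ ih =>
    intro hpos k hk P hP h0 h1 ν μ hν ⟨i, hi⟩
    obtain ⟨k, rfl⟩ : ∃ m, k = m + 1 := ⟨k - 1, by simp only [FO.rank] at hk; omega⟩
    rw [show (2 : ℤ) * 3 ^ (k + 1) = 3 * (2 * 3 ^ k) by ring] at hP
    obtain ⟨q, hq0, hq1, hQ⟩ := hP.exists_insert_swap hR (hpow k) h0 h1 (p := (i : ℕ))
      (by simp) (by have := i.2; simp only; omega)
    simp only at hq0 hq1
    lift q to ℕ using hq0
    refine ⟨⟨q, by omega⟩, ih hpos (Nat.le_of_succ_le_succ hk) hQ (Finset.mem_insert_of_mem h0)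
      (Finset.mem_insert_of_mem h1) _ _ (hcons i ⟨q, by omega⟩ hν) hi⟩
  | all φ ih =>
    intro hpos k hk P hP h0 h1 ν μ hν h j
    obtain ⟨k, rfl⟩ : ∃ m, k = m + 1 := ⟨k - 1, by simp only [FO.rank] at hk; omega⟩
    rw [show (2 : ℤ) * 3 ^ (k + 1) = 3 * (2 * 3 ^ k) by ring] at hP
    obtain ⟨p, hp0, hp1, hQ⟩ := hP.exists_insert hR (hpow k) h0 h1 (q := (j : ℕ))
      (by simp) (by have := j.2; simp only; omega)
    simp only at hp0 hp1
    lift p to ℕ using hp0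
    exact ih hpos (Nat.le_of_succ_le_succ hk) hQ (Finset.mem_insert_of_mem h0)
      (Finset.mem_insert_of_mem h1) _ _ (hcons ⟨p, by omega⟩ j hν) (h ⟨p, by omega⟩)
  | neg φ ih => intro hpos; exact hpos.elim

/-! ### Two words that positive formulas of small rank do not separate -/

/-- The word of length `n` whose letter at position `i` is full if `i % 3 ∈ T`, and empty
otherwise. -/
def periodicWord (S : Type*) (T : Set ℕ) (n : ℕ) : List (Set S) :=
  List.ofFn fun i : Fin n => {_a : S | (i : ℕ) % 3 ∈ T}

theorem marked_periodicWord {a : S} {T : Set ℕ} {n i : ℕ} :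
    Marked a (periodicWord S T n) i ↔ i < n ∧ i % 3 ∈ T := by
  simp [Marked, periodicWord]

theorem not_foPosDefinable_tripleLanguage (a : S) : ¬ FOPosDefinable (tripleLanguage a) := by
  rintro ⟨φ, hpos, hφ⟩
  set N : ℕ := 2 * 3 ^ φ.rank with hN
  set u := periodicWord S {0} (3 * N + 1) with hu
  set v := periodicWord S {0, 1} (3 * N + 2) with hv
  have hul : u.length = 3 * N + 1 := by simp [hu, periodicWord]
  have hvl : v.length = 3 * N + 2 := by simp [hv, periodicWord]
  have hmem : ∀ w, w ∈ tripleLanguage a ↔ φ.Sat w Fin.elim0 := fun w => by rw [← hφ]; rfl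
  have hu_mem : u ∈ tripleLanguage a := Or.inr ⟨by omega, fun i hi h3 =>
    marked_periodicWord.2 ⟨by omega, h3⟩⟩
  have hv_notMem : v ∉ tripleLanguage a := by
    rintro (⟨i, h0, h1, h2⟩ | ⟨hl, -⟩)
    · rw [hv, marked_periodicWord] at h0 h1 h2
      simp only [Set.mem_insert_iff, Set.mem_singleton_iff] at h0 h1 h2
      omega
    · omega
  refine hv_notMem ((hmem v).2 ?_)
  -- The pairs of end points have differences `0` and `-1`; a pair `(i, j)` with such a difference
  -- modulo `3` and `i` divisible by `3` has `j` congruent to `0` or `1`, hence marked.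
  refine hpos.sat_of_isConfig (R := fun z => z % 3 = 0 ∨ z % 3 = 2) (fun z hz => by omega) ?_ φ le_rfl
    (P := {(0, 0), ((u.length : ℤ) - 1, (v.length : ℤ) - 1)}) ⟨?_, ?_⟩ (by simp) (by simp)
    Fin.elim0 _ (fun x => x.elim0) ((hmem u).1 hu_mem)
  · intro i j hij b hb
    have hi : (i : ℕ) % 3 ∈ ({0} : Set ℕ) :=
      (marked_periodicWord.1 (⟨i.2, hb⟩ : Marked b u i)).2
    have hj : Marked b v j := by
      refine marked_periodicWord.2 ⟨hvl ▸ j.2, ?_⟩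
      simp only [Set.mem_insert_iff, Set.mem_singleton_iff] at hi ⊢
      omega
    exact hj.2
  · simp only [Finset.mem_insert, Finset.mem_singleton]
    rintro x (rfl | rfl)
    · exact Or.inl rfl
    · simp only [hul, hvl]
      omega
  · have hNZ : (2 * 3 ^ φ.rank : ℤ) = N := by simp [hN]
    simp only [Finset.mem_insert, Finset.mem_singleton, hNZ, Compat, hul, hvl]
    rintro x (rfl | rfl) y (rfl | rfl) <;>
      first | exact Or.inl rfl | (simp only; omega)

end WordLogic

theorem proposition4p5 (S : Type*) [Finite S] [Nonempty S] :
    ∃ L : Language (Set S),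
      WordLogic.IsMonotone L ∧ WordLogic.FODefinable L ∧ ¬ WordLogic.FOPosDefinable L := by
  obtain ⟨a⟩ := ‹Nonempty S›
  exact ⟨WordLogic.tripleLanguage a, WordLogic.isMonotone_tripleLanguage a,
    WordLogic.foDefinable_tripleLanguage a, WordLogic.not_foPosDefinable_tripleLanguage a⟩
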